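/- Let $k$ be a field, let $m\ge 2$, let $\mathcal G=(x_{i,j})_{1\le i,j\le m}$ be the generic $m\times m$ matrix, whose entries are independent variables over $k$, let $R=k[x_{i,j}\mid 1\le i,j\le m]$, and let $\mathcal P=I_{m-1}(\mathcal G)\subset R$ be the ideal generated by the submaximal minors of $\mathcal G$, i.e. the determinants of its $(m-1)\times(m-1)$ submatrices. The main anti-diagonal of the minor with rows $i_1<\cdots<i_{m-1}$ and columns $j_1<\cdots<j_{m-1}$ consists of the entries $x_{i_p,\,j_{m-p}}$, $1\le p\le m-1$. Let $\mathcal X$ be the set of those entries of $\mathcal G$ that lie on the main anti-diagonal of no submaximal minor. Then $\mathcal X$ has exactly $(m-1)(m-2)$ elements, and these elements, in any order, form a regular sequence on $R/\mathcal P$: for every ordering $a_1,\ldots,a_N$ of $\mathcal X$, with $N=(m-1)(m-2)$, each $a_{i}$ is a non-zero-divisor on $R/(\mathcal P,a_1,\ldots,a_{i-1})$, and $R/(\mathcal P,a_1,\ldots,a_N)\neq 0$. -/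

import Mathlib

/-- The ideal `I_r(M)` generated by the `r`-minors of the matrix `M`. A minor is given by a choice
of `r` rows and `r` columns, both listed in increasing order. -/
def minorsIdeal {R : Type*} [CommRing R] {m n : ℕ} (r : ℕ) (M : Matrix (Fin m) (Fin n) R) :
    Ideal R :=
  Ideal.span {d | ∃ (f : Fin r ↪o Fin m) (g : Fin r ↪o Fin n), d = (M.submatrix f g).det}

/-- The positions on the main anti-diagonal (from the upper right to the lower left corner) of the
square submatrix with rows `f 0 < f 1 < ⋯` and columns `g 0 < g 1 < ⋯`. -/
def mainAntidiagonal {m n r : ℕ} (f : Fin r ↪o Fin m) (g : Fin r ↪o Fin n) :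
    Set (Fin m × Fin n) :=
  {e | ∃ p : Fin r, e = (f p, g p.rev)}

/-- The positions of an `m × m` matrix that lie on the main anti-diagonal of no submaximal
(that is, `(m - 1) × (m - 1)`) minor. -/
def offAntidiagonals (m : ℕ) : Set (Fin m × Fin m) :=
  {e | ∀ f g : Fin (m - 1) ↪o Fin m, e ∉ mainAntidiagonal f g}

/-!
Call a monomial anti-diagonal free if, for every submaximal minor, it misses some entry of the main
anti-diagonal. The anti-diagonal free monomials form a basis of `R / P`. They span because every
minor rewrites its anti-diagonal term into monomials of smaller weight.

For independence, let `G ≠ 0` be a combination of such monomials and choose one of minimal weight.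
It misses four entries, one on the anti-diagonal of each of the four minors that delete one of two
rows and one of two columns. Solving for these four entries by successive approximation produces a
one-parameter deformation of the generic matrix whose four entries vanish at parameter `0` and whose
four minors are divisible by a high power of the parameter; then so are all submaximal minors,
because those four share a minor of size `m - 2` that is a unit. If `G ∈ P`, substituting the
deformation into `G` shows that its part of minimal weight lies in the ideal generated by the four
variables, which contradicts the choice of the monomial.

Finally, multiplication by a variable off all the anti-diagonals maps the monomial basis
injectively into itself, so these variables form a regular sequence in any order.
-/

open MvPolynomial

section MonomialBasis

variable {τ R : Type*} [CommRing R] {I : Ideal (MvPolynomial τ R)} {B : Set (τ →₀ ℕ)} {E : Set τ}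

theorem codisjoint_restrictSupport_of_reduction (ρ : (τ →₀ ℕ) → ℕ)
    (h : ∀ b ∉ B, ∃ G ∈ restrictSupport R {c | ρ c < ρ b}, monomial b 1 - G ∈ I) :
    Codisjoint (I.restrictScalars R) (restrictSupport R B) := by
  set V := I.restrictScalars R ⊔ restrictSupport R B
  have of_monomials (F : MvPolynomial τ R) (hF : ∀ b ∈ F.support, monomial b 1 ∈ V) : F ∈ V := by
    rw [F.as_sum]
    refine V.sum_mem fun b hb => ?_
    simpa only [smul_monomial, smul_eq_mul, mul_one] using V.smul_mem (coeff b F) (hF b hb)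
  have monomial_mem (n : ℕ) : ∀ b, ρ b < n → monomial b 1 ∈ V := by
    induction n with
    | zero => exact fun b hb => absurd hb (Nat.not_lt_zero _)
    | succ n ih =>
      intro b hb
      by_cases hbB : b ∈ B
      · exact Submodule.mem_sup_right ((monomial_mem_restrictSupport ..).mpr (Or.inl hbB))
      · obtain ⟨G, hG, hGI⟩ := h b hbB
        have hGV : G ∈ V := of_monomials G fun c hc =>
          ih c (((mem_restrictSupport_iff ..).mp hG hc).trans_le (Nat.le_of_lt_succ hb))
        rw [← sub_add_cancel (monomial b 1) G]
        exact V.add_mem (Submodule.mem_sup_left hGI) hGV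
  exact codisjoint_iff.mpr <| eq_top_iff.mpr fun F _ =>
    of_monomials F fun b _ => monomial_mem _ b (Nat.lt_succ_self _)

theorem mul_X_mem_restrictSupport {e : τ} (he : ∀ b ∈ B, b + Finsupp.single e 1 ∈ B)
    {F : MvPolynomial τ R} (hF : F ∈ restrictSupport R B) : F * X e ∈ restrictSupport R B := by
  rw [mem_restrictSupport_iff] at hF ⊢
  intro b hb
  rw [Finset.mem_coe, support_mul_X, Finset.mem_map] at hb
  obtain ⟨c, hc, rfl⟩ := hb
  exact he c (hF hc)

theorem exists_mem_restrictSupport_sub_mem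
    (hIB : IsCompl (I.restrictScalars R) (restrictSupport R B)) (F : MvPolynomial τ R) :
    ∃ G ∈ restrictSupport R B, F - G ∈ I := by
  obtain ⟨P, G, hP, hG, rfl⟩ := Submodule.codisjoint_iff_exists_add_eq.mp hIB.codisjoint F
  exact ⟨G, hG, by simpa using hP⟩

theorem mem_span_X_of_mem_sup (hIB : IsCompl (I.restrictScalars R) (restrictSupport R B))
    (hE : ∀ b ∈ B, ∀ e ∈ E, b + Finsupp.single e 1 ∈ B) {F : MvPolynomial τ R}
    (hF : F ∈ restrictSupport R B) (hFI : F ∈ I ⊔ Ideal.span (X '' E)) :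
    F ∈ Ideal.span (X '' E) := by
  set J : Ideal (MvPolynomial τ R) := Ideal.span (X '' E)
  have reduce_mem_J : ∀ H ∈ J, ∃ G ∈ restrictSupport R B, G ∈ J ∧ H - G ∈ I := by
    intro H hH
    induction hH using Submodule.closure_induction with
    | zero => exact ⟨0, Submodule.zero_mem _, J.zero_mem, by simp⟩
    | add H₁ H₂ _ _ h₁ h₂ =>
      obtain ⟨G₁, hG₁, hGJ₁, hGI₁⟩ := h₁
      obtain ⟨G₂, hG₂, hGJ₂, hGI₂⟩ := h₂
      refine ⟨G₁ + G₂, Submodule.add_mem _ hG₁ hG₂, J.add_mem hGJ₁ hGJ₂, ?_⟩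
      rw [add_sub_add_comm]
      exact I.add_mem hGI₁ hGI₂
    | smul_mem a H hH =>
      obtain ⟨e, he, rfl⟩ := hH
      obtain ⟨G, hG, hGI⟩ := exists_mem_restrictSupport_sub_mem hIB a
      refine ⟨G * X e, mul_X_mem_restrictSupport (fun b hb => hE b hb e he) hG,
        J.mul_mem_left _ (Ideal.subset_span ⟨e, he, rfl⟩), ?_⟩
      rw [smul_eq_mul, ← sub_mul]
      exact I.mul_mem_right _ hGI
  obtain ⟨P, hP, H, hH, rfl⟩ := Submodule.mem_sup.mp hFI
  obtain ⟨G, hG, hGJ, hGI⟩ := reduce_mem_J H hH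
  have h0 : P + H - G = 0 := Submodule.disjoint_def.mp hIB.disjoint _
    (by rw [add_sub_assoc]; exact I.add_mem hP hGI) (Submodule.sub_mem _ hF hG)
  rwa [sub_eq_zero.mp h0]

theorem mem_sup_span_X_of_mul_X_mem (hIB : IsCompl (I.restrictScalars R) (restrictSupport R B))
    (hE : ∀ b ∈ B, ∀ e ∈ E, b + Finsupp.single e 1 ∈ B) {e : τ} (heE : e ∉ E)
    (he : ∀ b ∈ B, b + Finsupp.single e 1 ∈ B) {F : MvPolynomial τ R}
    (hF : F * X e ∈ I ⊔ Ideal.span (X '' E)) : F ∈ I ⊔ Ideal.span (X '' E) := by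
  obtain ⟨G, hG, hGI⟩ := exists_mem_restrictSupport_sub_mem hIB F
  have hGX : G * X e ∈ Ideal.span (X '' E) := by
    refine mem_span_X_of_mem_sup hIB hE (mul_X_mem_restrictSupport he hG) ?_
    rw [← sub_sub_cancel (F * X e) (G * X e), ← sub_mul]
    exact Ideal.sub_mem _ hF (Ideal.mem_sup_left (I.mul_mem_right _ hGI))
  have hGE : G ∈ Ideal.span (X '' E) := by
    rw [mem_ideal_span_X_image] at hGX ⊢
    intro b hb
    obtain ⟨e', he', hbe'⟩ := hGX (b + Finsupp.single e 1) (by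
      rw [mem_support_iff, coeff_mul_X]
      exact mem_support_iff.mp hb)
    have hne : e ≠ e' := fun h => heE (h ▸ he')
    exact ⟨e', he', by simpa [Finsupp.single_apply, hne] using hbe'⟩
  rw [← sub_add_cancel F G]
  exact Submodule.add_mem_sup hGI hGE

theorem mk_mem_smul_top_iff {S : Type*} [CommRing S] {I J : Ideal S} {x : S} :
    Submodule.Quotient.mk x ∈ (J • ⊤ : Submodule S (S ⧸ I)) ↔ x ∈ I ⊔ J := by
  have h : (J • ⊤ : Submodule S (S ⧸ I)) = Submodule.map I.mkQ J := by
    rw [← I.range_mkQ, ← Submodule.map_top, ← Submodule.map_smul'', smul_eq_mul, Ideal.mul_top]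
  rw [h, ← Submodule.mkQ_apply, ← Submodule.mem_comap, Submodule.comap_map_mkQ]

theorem isRegular_map_X [Nontrivial R]
    (hIB : IsCompl (I.restrictScalars R) (restrictSupport R B)) (h0 : 0 ∈ B) {l : List τ}
    (hl : l.Nodup) (hlB : ∀ b ∈ B, ∀ e ∈ l, b + Finsupp.single e 1 ∈ B) :
    RingTheory.Sequence.IsRegular (MvPolynomial τ R ⧸ I) (l.map (X (R := R))) := by
  have ofList_map_X (l : List τ) : Ideal.ofList (l.map (X (R := R))) =
      Ideal.span (X '' {e | e ∈ l}) :=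
    congrArg Ideal.span (Set.ext fun F => by simp)
  refine ⟨⟨fun i hi => ?_⟩, fun htop => ?_⟩
  · rw [List.length_map] at hi
    rw [isSMulRegular_quotient_iff_mem_of_smul_mem, ← List.map_take, ofList_map_X, List.getElem_map]
    intro x hx
    obtain ⟨F, rfl⟩ := Submodule.Quotient.mk_surjective _ x
    rw [← Submodule.Quotient.mk_smul, mk_mem_smul_top_iff, smul_eq_mul, mul_comm] at hx
    have hnot_mem : l[i] ∉ l.take i := by
      rw [List.mem_take_iff_getElem]
      rintro ⟨j, hj, hij⟩
      rw [hl.getElem_inj_iff] at hij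
      omega
    exact mk_mem_smul_top_iff.mpr <| mem_sup_span_X_of_mul_X_mem hIB
      (fun b hb e he => hlB b hb e (List.mem_of_mem_take he)) hnot_mem
      (fun b hb => hlB b hb _ (List.getElem_mem hi)) hx
  · have h1 : (1 : MvPolynomial τ R) ∈ I ⊔ Ideal.span (X '' {e | e ∈ l}) := by
      rw [← ofList_map_X, ← mk_mem_smul_top_iff, ← htop]
      exact Submodule.mem_top
    have h2 := mem_span_X_of_mem_sup (E := {e | e ∈ l}) hIB hlB
      ((monomial_mem_restrictSupport ..).mpr (Or.inl h0)) h1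
    rw [mem_ideal_span_X_image] at h2
    obtain ⟨e, -, he⟩ := h2 0 (by simp)
    exact he rfl

end MonomialBasis

section Reduction

theorem sum_comp_perm_mul_lt_sum_mul {S : Type*} [Semiring S] [LinearOrder S]
    [IsStrictOrderedRing S] [ExistsAddOfLE S] {r : ℕ} {f g : Fin r → S} (hf : StrictMono f)
    (hg : StrictMono g) {σ : Equiv.Perm (Fin r)} (hσ : σ ≠ 1) :
    ∑ p, f (σ p) * g p < ∑ p, f p * g p := by
  have hfg : Monovary f g := hf.monotone.monovary hg.monotone
  refine hfg.sum_comp_perm_mul_lt_sum_mul_iff.mpr fun h => hσ ?_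
  refine (Equiv.Perm.monotone_iff σ).mp fun p q hpq => ?_
  rcases hpq.eq_or_lt with rfl | hpq
  · exact le_rfl
  · exact hf.le_iff_le.mp (h (hg hpq))

theorem sum_single_le {ι τ : Type*} [Fintype ι] {e : ι → τ} (he : e.Injective) {b : τ →₀ ℕ}
    (hb : ∀ i, b (e i) ≠ 0) : ∑ i, Finsupp.single (e i) 1 ≤ b := by
  classical
  intro x
  rw [Finsupp.finsetSum_apply]
  simp only [Finsupp.single_apply]
  rw [Finset.sum_boole, Nat.cast_id]
  rcases Finset.eq_empty_or_nonempty {i | e i = x} with h | ⟨i, hi⟩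
  · simp [h]
  · obtain rfl : e i = x := by simpa using hi
    refine le_trans (Finset.card_le_one.mpr fun j hj k hk => he ?_)
      (Nat.one_le_iff_ne_zero.mpr (hb i))
    exact (Finset.mem_filter.mp hj).2.trans (Finset.mem_filter.mp hk).2.symm

theorem det_submatrix_mvPolynomialX {R ι μ ν : Type*} [CommRing R] [Fintype ι] [DecidableEq ι]
    (f : ι → μ) (g : ι → ν) :
    ((Matrix.mvPolynomialX μ ν R).submatrix f g).det = ∑ σ : Equiv.Perm ι,
      (Equiv.Perm.sign σ : ℤ) • monomial (∑ i, Finsupp.single (f (σ i), g i) 1) 1 := by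
  simp only [Matrix.det_apply', Matrix.submatrix_apply, Matrix.mvPolynomialX_apply,
    monomial_sum_one, X, zsmul_eq_mul]

theorem det_submatrix_rev_mem_minorsIdeal {R : Type*} [CommRing R] {m n r : ℕ}
    (M : Matrix (Fin m) (Fin n) R) (f : Fin r ↪o Fin m) (g : Fin r ↪o Fin n) :
    (M.submatrix f fun p => g p.rev).det ∈ minorsIdeal r M := by
  rw [show (M.submatrix f fun p => g p.rev) = (M.submatrix f g).submatrix id Fin.revPerm from rfl,
    Matrix.det_permute']
  exact Ideal.mul_mem_left _ _ (Ideal.subset_span ⟨f, g, rfl⟩)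

/-- The exponents of the monomials in the entries of an `m × n` matrix that are divisible by the
main antidiagonal term of no `r`-minor. They index a monomial basis modulo the `r`-minors. -/
def antidiagFree (m n r : ℕ) : Set (Fin m × Fin n →₀ ℕ) :=
  {b | ∀ (f : Fin r ↪o Fin m) (g : Fin r ↪o Fin n), ∃ e ∈ mainAntidiagonal f g, b e = 0}

-- The antidiagonal term of a minor is its only term of greatest weight for `i * (n - 1 - j)`.
theorem codisjoint_minorsIdeal_restrictSupport_antidiagFree (R : Type*) [CommRing R] (m n r : ℕ) :
    Codisjoint ((minorsIdeal r (Matrix.mvPolynomialX (Fin m) (Fin n) R)).restrictScalars R)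
      (restrictSupport R (antidiagFree m n r)) := by
  refine codisjoint_restrictSupport_of_reduction
    (Finsupp.weight fun e : Fin m × Fin n => (e.1 : ℕ) * e.2.rev) fun b hb => ?_
  obtain ⟨f, g, hfg⟩ : ∃ (f : Fin r ↪o Fin m) (g : Fin r ↪o Fin n),
      ∀ p, b (f p, g p.rev) ≠ 0 := by
    simpa [antidiagFree, mainAntidiagonal] using hb
  let d (σ : Equiv.Perm (Fin r)) : Fin m × Fin n →₀ ℕ := ∑ p, .single (f (σ p), g p.rev) 1
  have weight_d_lt {σ} (hσ : σ ≠ 1) : Finsupp.weight (fun e => (e.1 : ℕ) * e.2.rev) (d σ) <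
      Finsupp.weight (fun e => (e.1 : ℕ) * e.2.rev) (d 1) := by
    simpa [d, Finsupp.weight_single] using
      sum_comp_perm_mul_lt_sum_mul (f := fun p => (f p : ℕ)) (g := fun p => ((g p.rev).rev : ℕ))
        f.strictMono (fun p q hpq => by simpa [-Fin.val_rev] using hpq) hσ
  obtain ⟨c, rfl⟩ : ∃ c, b = c + d 1 := by
    have hd : d 1 ≤ b := sum_single_le (e := fun p => (f p, g p.rev))
      (fun p q hpq => f.injective (congrArg Prod.fst hpq)) hfg
    exact ⟨b - d 1, (tsub_add_cancel_of_le hd).symm⟩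
  refine ⟨-∑ σ ∈ Finset.univ.erase 1, (Equiv.Perm.sign σ : ℤ) • monomial (c + d σ) 1,
    neg_mem (sum_mem fun σ hσ => zsmul_mem ?_ _), ?_⟩
  · refine (monomial_mem_restrictSupport ..).mpr (Or.inl ?_)
    simpa using weight_d_lt (Finset.ne_of_mem_erase hσ)
  · convert Ideal.mul_mem_left _ (monomial c 1) (det_submatrix_rev_mem_minorsIdeal
      (Matrix.mvPolynomialX (Fin m) (Fin n) R) f g) using 1
    simp only [det_submatrix_mvPolynomialX, Finset.mul_sum, mul_smul_comm, monomial_mul, mul_one]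
    rw [sub_neg_eq_add, ← Finset.add_sum_erase _ _ (Finset.mem_univ 1)]
    simp [d]

end Reduction

section BorderedMinors

open Matrix

variable {S μ ν α : Type*} [CommRing S] [Fintype α] [DecidableEq α]

theorem det_mul_eq_zero_of_card_lt {κ : Type*} [Fintype κ]
    (h : Fintype.card κ < Fintype.card α) (U : Matrix α κ S) (V : Matrix κ α S) :
    (U * V).det = 0 := by
  obtain ⟨d, hd⟩ : ∃ d, Fintype.card α = Fintype.card κ + (d + 1) :=
    Nat.exists_eq_add_of_lt h
  let e : α ≃ κ ⊕ Fin (d + 1) := Fintype.equivOfCardEq (by simpa using hd)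
  have hUV : U * V = (fromCols U (0 : Matrix α (Fin (d + 1)) S)).submatrix id e *
      (fromRows V (0 : Matrix (Fin (d + 1)) α S)).submatrix e id := by
    rw [submatrix_mul_equiv, fromCols_mul_fromRows, Matrix.mul_zero, add_zero, submatrix_id_id]
  rw [hUV, det_mul, det_eq_zero_of_column_eq_zero (e.symm (Sum.inr 0)) fun i => by simp, zero_mul]

theorem det_submatrix_eq_zero_of_range_eq {β : Type*} [Fintype β] [DecidableEq β]
    (M : Matrix μ ν S) {f : α → μ} {f' : β → μ} {g : α → ν} {g' : β → ν} (hf : f.Injective)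
    (hf' : f'.Injective) (hg : g.Injective) (hg' : g'.Injective)
    (hff' : Set.range f = Set.range f') (hgg' : Set.range g = Set.range g')
    (h : (M.submatrix f g).det = 0) : (M.submatrix f' g').det = 0 := by
  let e₁ : β ≃ α := (Equiv.ofInjective f' hf').trans <|
    (Equiv.setCongr hff'.symm).trans (Equiv.ofInjective f hf).symm
  let e₂ : β ≃ α := (Equiv.ofInjective g' hg').trans <|
    (Equiv.setCongr hgg'.symm).trans (Equiv.ofInjective g hg).symm
  have he₁ (b) : f (e₁ b) = f' b := Equiv.apply_ofInjective_symm hf _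
  have he₂ (b) : g (e₂ b) = g' b := Equiv.apply_ofInjective_symm hg _
  have hM : M.submatrix f' g' =
      ((M.submatrix f g).submatrix id (e₁.symm.trans e₂)).submatrix e₁ e₁ := by
    ext b b'
    simp [he₁, he₂]
  rw [hM, det_submatrix_equiv_self, det_permute', h, mul_zero]

theorem eq_mul_inv_mul_of_bordered {M : Matrix μ ν S} {u : α → μ} {v : α → ν}
    (huv : IsUnit (M.submatrix u v).det)
    (h : ∀ a c,
      (M.submatrix (Sum.elim u fun _ : Unit => a) (Sum.elim v fun _ : Unit => c)).det = 0) :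
    M = M.submatrix id v * (M.submatrix u v)⁻¹ * M.submatrix u id := by
  let _ : Invertible (M.submatrix u v) := invertibleOfIsUnitDet _ huv
  ext a c
  have hblocks : M.submatrix (Sum.elim u fun _ : Unit => a) (Sum.elim v fun _ : Unit => c) =
      fromBlocks (M.submatrix u v) (M.submatrix u fun _ => c) (M.submatrix (fun _ => a) v)
        (M.submatrix (fun _ => a) fun _ => c) := by
    ext (_ | _) (_ | _) <;> rfl
  have hac := h a c
  rw [hblocks, det_fromBlocks₁₁, huv.mul_right_eq_zero, det_unique, Matrix.sub_apply, sub_eq_zero,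
    invOf_eq_nonsing_inv] at hac
  exact hac

theorem det_submatrix_eq_zero_of_bordered {β : Type*} [Fintype β] [DecidableEq β]
    {M : Matrix μ ν S} {u : α → μ} {v : α → ν} (huv : IsUnit (M.submatrix u v).det)
    (h : ∀ a c, (M.submatrix (Sum.elim u fun _ : Unit => a) (Sum.elim v fun _ : Unit => c)).det = 0)
    (hβ : Fintype.card α < Fintype.card β) (f : β → μ) (g : β → ν) :
    (M.submatrix f g).det = 0 := by
  rw [eq_mul_inv_mul_of_bordered huv h, submatrix_mul _ _ f id g Function.bijective_id]
  exact det_mul_eq_zero_of_card_lt hβ _ _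

theorem range_sumElim_val_eq_range_succAbove {n : ℕ} {i j a b : Fin (n + 1)}
    (hab : (a = i ∧ b = j) ∨ (a = j ∧ b = i)) (hij : i ≠ j) :
    Set.range (Sum.elim (Subtype.val : {p // p ≠ i ∧ p ≠ j} → _) fun _ : Unit => a) =
      Set.range b.succAbove := by
  rw [Fin.range_succAbove, Set.Sum.elim_range, Subtype.range_coe_subtype, Set.range_const]
  ext p
  simp only [Set.mem_union, Set.mem_ofPred_eq, Set.mem_singleton_iff, Set.mem_compl_iff]
  grind

theorem det_submatrix_eq_zero_of_corner_minors {n : ℕ} {M : Matrix (Fin (n + 1)) (Fin (n + 1)) S}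
    {i j : Fin (n + 1)} (hij : i ≠ j)
    (hunit : IsUnit (M.submatrix (Subtype.val : {p // p ≠ i ∧ p ≠ j} → _) Subtype.val).det)
    (hminor : ∀ a ∈ ({i, j} : Set _), ∀ c ∈ ({i, j} : Set _),
      (M.submatrix a.succAbove c.succAbove).det = 0) (f g : Fin n → Fin (n + 1)) :
    (M.submatrix f g).det = 0 := by
  have hother {a} (ha : a ∈ ({i, j} : Set _)) :
      ∃ b ∈ ({i, j} : Set _), (a = i ∧ b = j) ∨ (a = j ∧ b = i) := by
    rcases ha with rfl | rfl
    · exact ⟨j, by simp⟩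
    · exact ⟨i, by simp⟩
  have hinj {a} (ha : a ∈ ({i, j} : Set _)) :
      (Sum.elim (Subtype.val : {p // p ≠ i ∧ p ≠ j} → _) fun _ : Unit => a).Injective :=
    Subtype.val_injective.sumElim (Function.injective_of_subsingleton _) (by grind)
  refine det_submatrix_eq_zero_of_bordered hunit (fun a c => ?_) ?_ f g
  · by_cases ha : a ∈ ({i, j} : Set _)
    · by_cases hc : c ∈ ({i, j} : Set _)
      · obtain ⟨a', ha', haa'⟩ := hother ha
        obtain ⟨c', hc', hcc'⟩ := hother hc
        exact det_submatrix_eq_zero_of_range_eq M Fin.succAbove_right_injective (hinj ha)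
          Fin.succAbove_right_injective (hinj hc)
          (range_sumElim_val_eq_range_succAbove haa' hij).symm
          (range_sumElim_val_eq_range_succAbove hcc' hij).symm (hminor a' ha' c' hc')
      · exact det_zero_of_column_eq (i := Sum.inl ⟨c, by simpa using hc⟩) (j := Sum.inr ())
          Sum.inl_ne_inr fun _ => rfl
    · exact det_zero_of_row_eq (i := Sum.inl ⟨a, by simpa using ha⟩) (j := Sum.inr ())
        Sum.inl_ne_inr rfl
  · have hcard := Nat.card_range_of_injective (hinj (a := i) (by simp))
    rw [range_sumElim_val_eq_range_succAbove (Or.inl ⟨rfl, rfl⟩) hij,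
      Nat.card_range_of_injective Fin.succAbove_right_injective] at hcard
    rw [Nat.card_eq_fintype_card, Nat.card_eq_fintype_card, Fintype.card_sum] at hcard
    exact (Nat.lt_succ_self _).trans_eq hcard.symm

theorem det_submatrix_mem_of_corner_minors_mem {n : ℕ} {M : Matrix (Fin (n + 1)) (Fin (n + 1)) S}
    {I : Ideal S} {i j : Fin (n + 1)} (hij : i ≠ j)
    (hunit : IsUnit (M.submatrix (Subtype.val : {p // p ≠ i ∧ p ≠ j} → _) Subtype.val).det)
    (hminor : ∀ a ∈ ({i, j} : Set _), ∀ c ∈ ({i, j} : Set _),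
      (M.submatrix a.succAbove c.succAbove).det ∈ I) (f g : Fin n → Fin (n + 1)) :
    (M.submatrix f g).det ∈ I := by
  let π := Ideal.Quotient.mk I
  have π_det {β : Type} [Fintype β] [DecidableEq β] (f g : β → Fin (n + 1)) :
      π (M.submatrix f g).det = ((M.map π).submatrix f g).det := by
    rw [RingHom.map_det, RingHom.mapMatrix_apply, submatrix_map]
  rw [← Ideal.Quotient.eq_zero_iff_mem, π_det]
  refine det_submatrix_eq_zero_of_corner_minors hij ?_ (fun a ha c hc => ?_) f g
  · rw [← π_det]
    exact hunit.map π
  · rw [← π_det]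
    exact Ideal.Quotient.eq_zero_iff_mem.mpr (hminor a ha c hc)

end BorderedMinors

section Deformation

theorem aeval_sub_aeval_mem {R S τ : Type*} [CommRing R] [CommRing S] [Algebra R S] {J : Ideal S}
    {y y' : τ → S} (h : ∀ e, y e - y' e ∈ J) (F : MvPolynomial τ R) :
    aeval y F - aeval y' F ∈ J := by
  have hcomp : (Ideal.Quotient.mkₐ R J).comp (aeval y) =
      (Ideal.Quotient.mkₐ R J).comp (aeval y') := by
    ext e
    simpa [Ideal.Quotient.eq] using h e
  exact Ideal.Quotient.eq.mp (DFunLike.congr_fun hcomp F)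

-- Fixed-point iteration: each step gains one power of `t` because of the factor `t` before `T s`.
theorem exists_pow_dvd_mul_add_mul_aeval {S ι τ : Type*} [CommRing S] (T : ι → MvPolynomial τ S)
    (e : ι → τ) (u : ι → Sˣ) (y₀ : τ → S) (t : S) (N : ℕ) :
    ∃ z : ι → S, (∀ s, t ∣ z s) ∧
      ∀ s, t ^ N ∣ u s * z s + t * aeval (Function.extend e z y₀) (T s) := by
  induction N with
  | zero => exact ⟨0, fun _ => dvd_zero t, fun _ => by simp⟩
  | succ N ih =>
    obtain ⟨z, -, hz⟩ := ih
    set y := Function.extend e z y₀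
    let z' (s : ι) : S := -(↑(u s)⁻¹ * (t * aeval y (T s)))
    set y' := Function.extend e z' y₀
    have hz' (s) : z' s - z s = -(↑(u s)⁻¹ * (u s * z s + t * aeval y (T s))) := by
      simp only [z', mul_add, Units.inv_mul_cancel_left]
      ring
    have hy' (x) : y' x - y x ∈ Ideal.span {t ^ N} := by
      simp only [y, y', Function.extend]
      split_ifs
      · rw [hz']
        exact neg_mem (Ideal.mul_mem_left _ _ (Ideal.mem_span_singleton.mpr (hz _)))
      · simp
    refine ⟨z', fun s => (dvd_mul_of_dvd_right (dvd_mul_right t _) _).neg_right, fun s => ?_⟩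
    have herror : u s * z' s + t * aeval y' (T s) = t * (aeval y' (T s) - aeval y (T s)) := by
      simp only [z', mul_neg, Units.mul_inv_cancel_left]
      ring
    rw [herror, pow_succ']
    exact mul_dvd_mul_left t (Ideal.mem_span_singleton.mp (aeval_sub_aeval_mem hy' (T s)))

/-- The matrix with entries `t ^ w (i, j) * y (i, j)`, a one-parameter deformation whose minors are
governed, for small `t`, by their terms of least weight. -/
def weightedMatrix {S μ ν : Type*} [CommRing S] (t : S) (w : μ × ν → ℕ) (y : μ × ν → S) :
    Matrix μ ν S :=
  .of fun i j => t ^ w (i, j) * y (i, j)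

variable {S μ ν ι : Type*} [CommRing S] [Fintype ι] [DecidableEq ι]

theorem exists_det_submatrix_weightedMatrix_eq {w : μ × ν → ℕ} {f : ι → μ} {g : ι → ν}
    (hw : ∀ σ : Equiv.Perm ι, σ ≠ 1 → ∑ p, w (f p, g p) < ∑ p, w (f (σ p), g p)) (t : S) :
    ∃ T : MvPolynomial (μ × ν) S, ∀ y, ((weightedMatrix t w y).submatrix f g).det =
      t ^ (∑ p, w (f p, g p)) * (∏ p, y (f p, g p) + t * aeval y T) := by
  choose! d hd using fun σ hσ => Nat.exists_eq_add_of_lt (hw σ hσ)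
  refine ⟨∑ σ ∈ Finset.univ.erase 1, (Equiv.Perm.sign σ : ℤ) • (C (t ^ d σ) *
    ∏ p, X (f (σ p), g p)), fun y => ?_⟩
  simp only [Matrix.det_apply', weightedMatrix, Matrix.submatrix_apply, Matrix.of_apply,
    Finset.prod_mul_distrib, Finset.prod_pow_eq_pow_sum, map_sum, map_zsmul, map_mul, map_prod,
    aeval_X, algHom_C, Algebra.algebraMap_self, RingHom.id_apply, mul_add, Finset.mul_sum]
  rw [← Finset.add_sum_erase _ _ (Finset.mem_univ 1)]
  congr 1
  · simp
  · refine Finset.sum_congr rfl fun σ hσ => ?_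
    rw [hd σ (Finset.ne_of_mem_erase hσ), zsmul_eq_mul]
    ring

theorem exists_pow_dvd_det_submatrix_weightedMatrix {κ : Type*} {w : μ × ν → ℕ} {f : κ → ι → μ}
    {g : κ → ι → ν}
    (hw : ∀ s, ∀ σ : Equiv.Perm ι, σ ≠ 1 → ∑ p, w (f s p, g s p) < ∑ p, w (f s (σ p), g s p))
    {e : κ → μ × ν} {p : κ → ι} (he : ∀ s s' q, (f s q, g s q) = e s' ↔ s' = s ∧ q = p s)
    (y₀ : μ × ν → Sˣ) (t : S) (N : ℕ) :
    ∃ y : μ × ν → S, (∀ s, t ∣ y (e s)) ∧ (∀ x ∉ Set.range e, y x = y₀ x) ∧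
      ∀ s, t ^ N ∣ ((weightedMatrix t w y).submatrix (f s) (g s)).det := by
  choose T hT using fun s => exists_det_submatrix_weightedMatrix_eq (hw s) t
  have he_self (s) : (f s (p s), g s (p s)) = e s := (he s s (p s)).mpr ⟨rfl, rfl⟩
  have he_inj : e.Injective := fun s s' h =>
    ((he s' s (p s')).mp ((he_self s').trans h.symm)).1
  let u (s : κ) : Sˣ := ∏ q ∈ Finset.univ.erase (p s), y₀ (f s q, g s q)
  obtain ⟨z, hz, hzN⟩ := exists_pow_dvd_mul_add_mul_aeval T e u (fun x => y₀ x) t N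
  set y := Function.extend e z fun x => (y₀ x : S)
  have hy (s) : y (e s) = z s := he_inj.extend_apply ..
  have hy₀ (x) (hx : x ∉ Set.range e) : y x = y₀ x := Function.extend_apply' _ _ _ hx
  refine ⟨y, fun s => (hy s).symm ▸ hz s, hy₀, fun s => ?_⟩
  have hprod : ∏ q, y (f s q, g s q) = u s * z s := by
    rw [← Finset.prod_erase_mul _ _ (Finset.mem_univ (p s)), he_self, hy, Units.coe_prod]
    refine congrArg (· * z s) (Finset.prod_congr rfl fun q hq => hy₀ _ ?_)
    rintro ⟨s', hs'⟩
    exact Finset.ne_of_mem_erase hq ((he s s' q).mp hs'.symm).2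
  rw [hT, hprod]
  exact (hzN s).mul_left _

end Deformation

section DistSq

/-- The weight `(i - j)²` of the position `(i, j)`: among the terms of a minor, the main diagonal is
the only one of least weight. -/
def distSq {m n : ℕ} (e : Fin m × Fin n) : ℕ :=
  ((e.1 : ℤ) - e.2).natAbs ^ 2

theorem distSq_eq_zero_iff {m : ℕ} {i j : Fin m} : distSq (i, j) = 0 ↔ i = j := by
  simp [distSq, sub_eq_zero, Fin.ext_iff]

theorem sum_distSq_lt_sum_distSq {m n r : ℕ} (f : Fin r ↪o Fin m) (g : Fin r ↪o Fin n)
    {σ : Equiv.Perm (Fin r)} (hσ : σ ≠ 1) :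
    ∑ p, distSq (f p, g p) < ∑ p, distSq (f (σ p), g p) := by
  have hlt : ∑ p, (f (σ p) : ℤ) * (g p : ℤ) < ∑ p, (f p : ℤ) * (g p : ℤ) :=
    sum_comp_perm_mul_lt_sum_mul (f := fun p => (f p : ℤ)) (g := fun p => (g p : ℤ))
      (fun p q hpq => by simpa using hpq) (fun p q hpq => by simpa using hpq) hσ
  have hsq : ∑ p, (f (σ p) : ℤ) ^ 2 = ∑ p, (f p : ℤ) ^ 2 :=
    Equiv.sum_comp σ fun p => (f p : ℤ) ^ 2
  zify
  simp only [distSq, Nat.cast_pow, Int.natCast_natAbs, sq_abs, sub_sq, Finset.sum_add_distrib,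
    Finset.sum_sub_distrib, hsq, mul_assoc, ← Finset.mul_sum]
  linarith

theorem isUnit_det_submatrix_weightedMatrix_distSq {A α : Type*} [CommRing A] [Fintype α]
    [DecidableEq α] {m : ℕ} {u : α → Fin m} (hu : u.Injective) {y : Fin m × Fin m → PowerSeries A}
    (hy : ∀ a, IsUnit (PowerSeries.constantCoeff (y (u a, u a)))) :
    IsUnit ((weightedMatrix PowerSeries.X distSq y).submatrix u u).det := by
  have hdiag : PowerSeries.constantCoeff.mapMatrix ((weightedMatrix .X distSq y).submatrix u u) =
      Matrix.diagonal fun a => PowerSeries.constantCoeff (y (u a, u a)) := by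
    ext a b
    rcases eq_or_ne a b with rfl | hab
    · simp [weightedMatrix, distSq_eq_zero_iff.mpr]
    · simp [weightedMatrix, Matrix.diagonal_apply_ne _ hab, distSq_eq_zero_iff, hu.ne hab]
  rw [PowerSeries.isUnit_iff_constantCoeff, RingHom.map_det, hdiag, Matrix.det_diagonal]
  exact IsUnit.prod_univ_iff.mpr hy

end DistSq

section Pivots

variable {n : ℕ} {i j : Fin (n + 1)} {k l : Fin n}

/-- The two indices `i` and `j`, whose rows and columns are deleted in turn. -/
def cornerIndex (i j : Fin (n + 1)) (s : Bool) : Fin (n + 1) :=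
  if s then i else j

/-- A diagonal position for each of the four submaximal minors obtained by deleting a row and a
column among the `i`-th and `j`-th: the minor that deletes row `cornerIndex i j s.1` and column
`cornerIndex i j s.2` has `pivotPosition i j k l s` on its main diagonal, and none of the three
others if `i ≤ k, l < j`. -/
def pivotPosition (i j : Fin (n + 1)) (k l : Fin n) : Bool × Bool → Fin (n + 1) × Fin (n + 1)
  | (true, true) => (j, j)
  | (false, false) => (i, i)
  | (true, false) => (k.succ, k.castSucc)
  | (false, true) => (l.castSucc, l.succ)

theorem val_succAbove (a : Fin (n + 1)) (p : Fin n) :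
    (a.succAbove p : ℕ) = if (p : ℕ) < a then (p : ℕ) else p + 1 := by
  grind [Fin.succAbove]

theorem exists_succAbove_eq_pivotPosition_iff (hk : k.castSucc ∈ Set.Ico i j)
    (hl : l.castSucc ∈ Set.Ico i j) (s : Bool × Bool) :
    ∃ p : Fin n, ∀ s' q, ((cornerIndex i j s.1).succAbove q, (cornerIndex i j s.2).succAbove q) =
      pivotPosition i j k l s' ↔ s' = s ∧ q = p := by
  have hij : i < j := hk.1.trans_lt hk.2
  rw [Set.mem_Ico, Fin.le_def, Fin.lt_def, Fin.val_castSucc] at hk hl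
  obtain ⟨p, hp⟩ : ∃ p : Fin n, (p : ℕ) = match s with
      | (true, true) => (j : ℕ) - 1
      | (false, false) => i
      | (true, false) => k
      | (false, true) => l := by
    refine ⟨⟨_, ?_⟩, rfl⟩
    rcases s with ⟨_ | _, _ | _⟩ <;> grind
  refine ⟨p, fun s' q => ?_⟩
  rcases s with ⟨_ | _, _ | _⟩ <;> rcases s' with ⟨_ | _, _ | _⟩ <;>
  · simp only [cornerIndex, pivotPosition, Prod.mk.injEq, Fin.ext_iff, val_succAbove, Fin.val_succ,
      Fin.val_castSucc, Bool.false_eq_true, Bool.true_eq_false, if_true, if_false] at hp ⊢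
    grind

theorem exists_range_pivotPosition_subset {Z : Set (Fin (n + 1) × Fin (n + 1))}
    (hZ : ∀ a c : Fin (n + 1), ∃ p, (a.succAbove p, c.succAbove p) ∈ Z) :
    ∃ (i j : Fin (n + 1)) (k l : Fin n), k.castSucc ∈ Set.Ico i j ∧ l.castSucc ∈ Set.Ico i j ∧
      Set.range (pivotPosition i j k l) ⊆ Z := by
  let D : Set (Fin (n + 1)) := {p | (p, p) ∈ Z}
  have hDne : D.Nonempty := (hZ 0 0).imp' _ fun _ hp => hp
  obtain ⟨i, hiD, hi⟩ := Set.exists_min_image D id D.toFinite hDne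
  obtain ⟨j, hjD, hj⟩ := Set.exists_max_image D id D.toFinite hDne
  have hij : i < j := by
    obtain ⟨p, hp⟩ := hZ i i
    exact ((hi _ hp).lt_of_ne (Fin.succAbove_ne i p).symm).trans_le (hj _ hp)
  obtain ⟨k, hk⟩ := hZ i j
  obtain ⟨l, hl⟩ := hZ j i
  have mem_Ico {p : Fin n} (hp : (i.succAbove p, j.succAbove p) ∈ Z ∨
      (j.succAbove p, i.succAbove p) ∈ Z) : p.castSucc ∈ Set.Ico i j := by
    by_contra h
    rcases lt_or_ge p.castSucc i with hpi | hpi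
    · rw [Fin.succAbove_of_castSucc_lt _ _ hpi, Fin.succAbove_of_castSucc_lt _ _ (hpi.trans hij),
        or_self] at hp
      exact hpi.not_ge (hi _ hp)
    · have hpj : j ≤ p.castSucc := not_lt.mp fun hpj => h ⟨hpi, hpj⟩
      rw [Fin.succAbove_of_le_castSucc _ _ hpi, Fin.succAbove_of_le_castSucc _ _ hpj, or_self] at hp
      exact (Fin.le_castSucc_iff.mp hpj).not_ge (hj _ hp)
  have hkI := mem_Ico (Or.inl hk)
  have hlI := mem_Ico (Or.inr hl)
  rw [Fin.succAbove_of_le_castSucc _ _ hkI.1, Fin.succAbove_of_castSucc_lt _ _ hkI.2] at hk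
  rw [Fin.succAbove_of_castSucc_lt _ _ hlI.2, Fin.succAbove_of_le_castSucc _ _ hlI.1] at hl
  refine ⟨i, j, k, l, hkI, hlI, ?_⟩
  rintro _ ⟨⟨_ | _, _ | _⟩, rfl⟩
  exacts [hiD, hl, hk, hjD]

theorem exists_lift_forall_X_pow_dvd_det_submatrix {A : Type*} [CommRing A]
    (hk : k.castSucc ∈ Set.Ico i j) (hl : l.castSucc ∈ Set.Ico i j)
    (y₀ : Fin (n + 1) × Fin (n + 1) → Aˣ) (N : ℕ) :
    ∃ y : Fin (n + 1) × Fin (n + 1) → PowerSeries A,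
      (∀ x ∈ Set.range (pivotPosition i j k l), PowerSeries.constantCoeff (y x) = 0) ∧
      (∀ x ∉ Set.range (pivotPosition i j k l), PowerSeries.constantCoeff (y x) = y₀ x) ∧
      ∀ f g : Fin n → Fin (n + 1),
        PowerSeries.X ^ N ∣ ((weightedMatrix PowerSeries.X distSq y).submatrix f g).det := by
  choose p hp using exists_succAbove_eq_pivotPosition_iff hk hl
  obtain ⟨y, hy, hy₀, hyN⟩ := exists_pow_dvd_det_submatrix_weightedMatrix
    (fun s σ hσ => sum_distSq_lt_sum_distSq (Fin.succAboveOrderEmb (cornerIndex i j s.1))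
      (Fin.succAboveOrderEmb (cornerIndex i j s.2)) hσ)
    hp (fun x => Units.map (PowerSeries.C (R := A)).toMonoidHom (y₀ x)) PowerSeries.X N
  refine ⟨y, ?_, fun x hx => by simp [hy₀ x hx], fun f g => ?_⟩
  · rintro _ ⟨s, rfl⟩
    exact PowerSeries.X_dvd_iff.mp (hy s)
  rw [← Ideal.mem_span_singleton]
  refine det_submatrix_mem_of_corner_minors_mem (hk.1.trans_lt hk.2).ne ?_ ?_ f g
  · refine isUnit_det_submatrix_weightedMatrix_distSq Subtype.val_injective fun a => ?_
    have ha : (a.1, a.1) ∉ Set.range (pivotPosition i j k l) := by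
      rintro ⟨⟨_ | _, _ | _⟩, hs⟩ <;>
      · simp only [pivotPosition, Prod.mk.injEq, Fin.ext_iff] at hs
        grind
    simp [hy₀ _ ha]
  · have hcorner {a} (ha : a ∈ ({i, j} : Set _)) : ∃ s, cornerIndex i j s = a := by
      rcases ha with rfl | rfl
      exacts [⟨true, rfl⟩, ⟨false, rfl⟩]
    intro a ha c hc
    obtain ⟨s, rfl⟩ := hcorner ha
    obtain ⟨s', rfl⟩ := hcorner hc
    exact Ideal.mem_span_singleton.mpr (hyN (s, s'))

end Pivots

section LeadingForm

variable {R A τ : Type*} [CommRing R] [CommRing A] [Algebra R A] {w : τ → ℕ} {W : ℕ}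
  {G : MvPolynomial τ R}

theorem coeff_aeval_X_pow_mul (y : τ → PowerSeries A)
    (hG : ∀ b ∈ G.support, W ≤ Finsupp.weight w b) :
    PowerSeries.coeff W (aeval (fun e => PowerSeries.X ^ w e * y e) G) =
      aeval (fun e => PowerSeries.constantCoeff (y e)) (weightedHomogeneousComponent w W G) := by
  classical
  have aeval_monomial_eq (b : τ →₀ ℕ) (c : R) :
      aeval (fun e => PowerSeries.X ^ w e * y e) (monomial b c) =
        PowerSeries.X ^ Finsupp.weight w b * aeval y (monomial b c) := by
    have hX : (b.prod fun e k => (PowerSeries.X (R := A) ^ w e) ^ k) =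
        PowerSeries.X ^ Finsupp.weight w b := by
      simp only [Finsupp.weight_apply, Finsupp.sum, Finsupp.prod, ← pow_mul,
        Finset.prod_pow_eq_pow_sum, smul_eq_mul, mul_comm]
    rw [aeval_monomial, aeval_monomial, ← hX]
    simp only [mul_pow, Finsupp.prod_mul]
    ring
  rw [weightedHomogeneousComponent_apply, Finset.sum_filter, map_sum]
  conv_lhs => rw [G.as_sum, map_sum, map_sum]
  refine Finset.sum_congr rfl fun b hb => ?_
  rw [aeval_monomial_eq, PowerSeries.coeff_X_pow_mul']
  rcases (hG b hb).eq_or_lt with h | h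
  · simp [← h, aeval_monomial, Finsupp.prod, PowerSeries.algebraMap_apply]
  · simp [h.not_ge, h.ne']

theorem weightedHomogeneousComponent_mem_span_X {α : MvPolynomial τ R →ₐ[R] A}
    (hα : Function.Injective α) {C₀ : Set τ} {y : τ → PowerSeries A}
    (hy : ∀ e ∈ C₀, PowerSeries.constantCoeff (y e) = 0)
    (hyα : ∀ e ∉ C₀, PowerSeries.constantCoeff (y e) = α (X e))
    (hG : ∀ b ∈ G.support, W ≤ Finsupp.weight w b)
    (hdvd : PowerSeries.X ^ (W + 1) ∣ aeval (fun e => PowerSeries.X ^ w e * y e) G) :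
    weightedHomogeneousComponent w W G ∈ Ideal.span (X '' C₀) := by
  classical
  let z (e : τ) : MvPolynomial τ R := if e ∈ C₀ then 0 else X e
  have hz : (fun e => PowerSeries.constantCoeff (y e)) = fun e => α (z e) := by
    funext e
    by_cases he : e ∈ C₀
    · simp [z, he, hy]
    · simp [z, he, hyα]
  have haeval : aeval z (weightedHomogeneousComponent w W G) = 0 := by
    refine hα ?_
    rw [map_zero, comp_aeval_apply, ← hz, ← coeff_aeval_X_pow_mul y hG]
    exact PowerSeries.X_pow_dvd_iff.mp hdvd W (Nat.lt_succ_self W)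
  have hsub (e) : X e - z e ∈ Ideal.span (X '' C₀ : Set (MvPolynomial τ R)) := by
    by_cases he : e ∈ C₀
    · simpa [z, he] using Ideal.subset_span (Set.mem_image_of_mem X he)
    · simp [z, he]
  have hmem := aeval_sub_aeval_mem hsub (weightedHomogeneousComponent w W G)
  rwa [haeval, sub_zero, aeval_X_left_apply] at hmem

end LeadingForm

section Independence

theorem aeval_mem_minorsIdeal {R S : Type*} [CommRing R] [CommRing S] [Algebra R S] {m n r : ℕ}
    (M : Matrix (Fin m) (Fin n) S) {F : MvPolynomial (Fin m × Fin n) R}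
    (hF : F ∈ minorsIdeal r (Matrix.mvPolynomialX (Fin m) (Fin n) R)) :
    aeval (fun e => M e.1 e.2) F ∈ minorsIdeal r M := by
  rw [← Ideal.mem_comap]
  refine Ideal.span_le.mpr ?_ hF
  rintro _ ⟨f, g, rfl⟩
  rw [SetLike.mem_coe, Ideal.mem_comap, AlgHom.map_det]
  refine Ideal.subset_span ⟨f, g, congrArg Matrix.det ?_⟩
  ext p q
  simp

theorem exists_succAbove_apply_rev_eq_zero {n : ℕ} {b : Fin (n + 1) × Fin (n + 1) →₀ ℕ}
    (hb : b ∈ antidiagFree (n + 1) (n + 1) n) (a c : Fin (n + 1)) :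
    ∃ p, b (a.succAbove p, (c.succAbove p).rev) = 0 := by
  obtain ⟨_, ⟨p, rfl⟩, hp⟩ := hb (Fin.succAboveOrderEmb a) (Fin.succAboveOrderEmb c.rev)
  exact ⟨p, by simpa [Fin.rev_succAbove] using hp⟩

theorem disjoint_minorsIdeal_restrictSupport_antidiagFree (R : Type*) [CommRing R] (n : ℕ) :
    Disjoint
      ((minorsIdeal n (Matrix.mvPolynomialX (Fin (n + 1)) (Fin (n + 1)) R)).restrictScalars R)
      (restrictSupport R (antidiagFree (n + 1) (n + 1) n)) := by
  refine Submodule.disjoint_def.mpr fun G hGI hG => by_contra fun hG0 => ?_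
  let w (e : Fin (n + 1) × Fin (n + 1)) : ℕ := distSq (e.1, e.2.rev)
  obtain ⟨b, hbG, hbmin⟩ :=
    Finset.exists_min_image G.support (Finsupp.weight w) (support_nonempty.mpr hG0)
  obtain ⟨i, j, k, l, hk, hl, hpivot⟩ := exists_range_pivotPosition_subset
    (Z := {x | b (x.1, x.2.rev) = 0})
    (exists_succAbove_apply_rev_eq_zero ((mem_restrictSupport_iff ..).mp hG hbG))
  let P := MvPolynomial (Fin (n + 1) × Fin (n + 1)) R
  let α : P →ₐ[R] FractionRing P := IsScalarTower.toAlgHom R P (FractionRing P)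
  have isUnit_α_X (e) : IsUnit (α (X e)) :=
    IsLocalization.map_units _ (⟨X e, isRegular_X.mem_nonZeroDivisors⟩ : nonZeroDivisors P)
  obtain ⟨y, hy, hyα, hdvd⟩ := exists_lift_forall_X_pow_dvd_det_submatrix hk hl
    (fun x => (isUnit_α_X (x.1, x.2.rev)).unit) (Finsupp.weight w b + 1)
  have hle : minorsIdeal n ((weightedMatrix PowerSeries.X distSq y).submatrix id Fin.rev) ≤
      Ideal.span {PowerSeries.X ^ (Finsupp.weight w b + 1)} := by
    refine Ideal.span_le.mpr ?_
    rintro _ ⟨f, g, rfl⟩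
    exact Ideal.mem_span_singleton.mpr (hdvd f fun p => (g p).rev)
  have hleading := weightedHomogeneousComponent_mem_span_X (α := α)
    (IsFractionRing.injective P (FractionRing P))
    (C₀ := {e | (e.1, e.2.rev) ∈ Set.range (pivotPosition i j k l)})
    (fun e he => hy _ he) (fun e he => by simpa using hyα _ he) hbmin
    (Ideal.mem_span_singleton.mp (hle (aeval_mem_minorsIdeal _ hGI)))
  obtain ⟨e, he, hbe⟩ := (mem_ideal_span_X_image.mp hleading) b (by
    rw [mem_support_iff, coeff_weightedHomogeneousComponent, if_pos rfl]
    exact mem_support_iff.mp hbG)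
  exact hbe (by simpa using hpivot he)

end Independence

section OffAntidiagonals

theorem exists_eq_succAboveOrderEmb {n : ℕ} (f : Fin n ↪o Fin (n + 1)) :
    ∃ a, f = Fin.succAboveOrderEmb a := by
  obtain ⟨a, ha⟩ : ∃ a, a ∉ Set.range f := by
    by_contra! h
    simpa using Fintype.card_le_of_surjective f h
  refine ⟨a, OrderEmbedding.range_inj.mp (Set.eq_of_subset_of_ncard_le ?_ ?_)⟩
  · simpa [Fin.range_succAbove] using ha
  · rw [Set.ncard_range_of_injective f.injective,
      Set.ncard_range_of_injective (RelEmbedding.injective _)]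

theorem mem_offAntidiagonals_iff_succAbove {n : ℕ} {e : Fin (n + 1) × Fin (n + 1)} :
    e ∈ offAntidiagonals (n + 1) ↔
      ∀ (a c : Fin (n + 1)) (p : Fin n), e ≠ (a.succAbove p, c.succAbove p.rev) := by
  refine ⟨fun he a c p hp => he (Fin.succAboveOrderEmb a) (Fin.succAboveOrderEmb c) ⟨p, hp⟩, ?_⟩
  rintro he f g ⟨p, hp⟩
  obtain ⟨a, rfl⟩ := exists_eq_succAboveOrderEmb f
  obtain ⟨c, rfl⟩ := exists_eq_succAboveOrderEmb g
  exact he a c p hp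

theorem mem_offAntidiagonals_iff {n : ℕ} (hn : 0 < n) {e : Fin (n + 1) × Fin (n + 1)} :
    e ∈ offAntidiagonals (n + 1) ↔ (e.1 + e.2 + 1 : ℕ) < n ∨ n + 1 < (e.1 + e.2 : ℕ) := by
  obtain ⟨i, j⟩ := e
  simp only [mem_offAntidiagonals_iff_succAbove, ne_eq, Prod.mk.injEq, Fin.ext_iff, val_succAbove,
    Fin.val_rev]
  constructor
  · intro h
    by_contra! hij
    by_cases hi : (i : ℕ) < n ∧ (i + j : ℕ) ≤ n
    · have hne := h (Fin.last n) (if (i + j : ℕ) < n then Fin.last n else 0) ⟨i, hi.1⟩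
      grind
    · have hne := h 0 (if (i + j : ℕ) ≤ n then Fin.last n else 0) ⟨i - 1, by omega⟩
      grind
  · intro h a c p
    split_ifs <;> omega

theorem ncard_offAntidiagonals (n : ℕ) : (offAntidiagonals (n + 2)).ncard = (n + 1) * n := by
  let φ (a : Fin (n + 1) × Fin (n + 1)) : Fin (n + 2) × Fin (n + 2) :=
    if a.1 < a.2 then (a.1.castSucc, a.2.succ.rev) else (a.1.succ, a.2.castSucc.rev)
  have val_φ (a b) : ((φ (a, b)).1 : ℕ) = (if a < b then a else a + 1 : ℕ) ∧
      ((φ (a, b)).2 : ℕ) = (if a < b then n - b else n + 1 - b : ℕ) := by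
    grind
  have himage : φ '' (Finset.univ : Finset (Fin (n + 1))).offDiag = offAntidiagonals (n + 2) := by
    ext ⟨i, j⟩
    simp only [mem_offAntidiagonals_iff n.succ_pos, Set.mem_image, Prod.exists, Finset.mem_coe,
      Finset.mem_offDiag, Finset.mem_univ, true_and, Prod.ext_iff, Fin.ext_iff, val_φ, ne_eq,
      Fin.lt_def]
    constructor
    · rintro ⟨a, b, hab, h⟩
      grind
    · rintro (h | h)
      · exact ⟨⟨i, by omega⟩, ⟨n - j, by omega⟩, by grind⟩
      · exact ⟨⟨i - 1, by omega⟩, ⟨n + 1 - j, by omega⟩, by grind⟩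
  have hinj : Set.InjOn φ (Finset.univ : Finset (Fin (n + 1))).offDiag := by
    rintro ⟨a, b⟩ hab ⟨c, d⟩ hcd h
    simp only [Finset.mem_coe, Finset.mem_offDiag, Finset.mem_univ, true_and, Prod.ext_iff,
      Fin.ext_iff, val_φ, ne_eq, Fin.lt_def] at hab hcd h ⊢
    grind
  rw [← himage, hinj.ncard_image, Set.ncard_coe_finset, Finset.offDiag_card]
  simp [← Nat.mul_sub_one]

theorem add_single_mem_antidiagFree {n : ℕ} {b : Fin (n + 1) × Fin (n + 1) →₀ ℕ}
    (hb : b ∈ antidiagFree (n + 1) (n + 1) n) {e : Fin (n + 1) × Fin (n + 1)}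
    (he : e ∈ offAntidiagonals (n + 1)) (k : ℕ) :
    b + Finsupp.single e k ∈ antidiagFree (n + 1) (n + 1) n := by
  intro f g
  obtain ⟨x, hx, hbx⟩ := hb f g
  have hxe : x ≠ e := fun h => he f g (h ▸ hx)
  exact ⟨x, hx, by simp [hbx, hxe]⟩

theorem zero_mem_antidiagFree (m n : ℕ) {r : ℕ} (hr : 0 < r) : 0 ∈ antidiagFree m n r :=
  fun _ _ => ⟨_, ⟨⟨0, hr⟩, rfl⟩, rfl⟩

end OffAntidiagonals

theorem lemma3p4_general (R : Type*) [CommRing R] [Nontrivial R] (m : ℕ) (hm : 2 ≤ m) :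
    (offAntidiagonals m).ncard = (m - 1) * (m - 2) ∧
    ∀ l : List (Fin m × Fin m), l.Nodup → (∀ e ∈ l, e ∈ offAntidiagonals m) →
      RingTheory.Sequence.IsRegular
        (MvPolynomial (Fin m × Fin m) R ⧸
          minorsIdeal (m - 1) (Matrix.mvPolynomialX (Fin m) (Fin m) R))
        (l.map fun e => Matrix.mvPolynomialX (Fin m) (Fin m) R e.1 e.2) := by
  obtain ⟨n, rfl⟩ := Nat.exists_eq_add_of_le' hm
  refine ⟨ncard_offAntidiagonals n, fun l hl hmem => ?_⟩
  exact isRegular_map_X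
    ⟨disjoint_minorsIdeal_restrictSupport_antidiagFree R (n + 1),
      codisjoint_minorsIdeal_restrictSupport_antidiagFree R (n + 2) (n + 2) (n + 1)⟩
    (zero_mem_antidiagFree _ _ n.succ_pos) hl
    fun b hb e he => add_single_mem_antidiagFree hb (hmem e he) 1

theorem lemma3p4 (K : Type*) [Field K] (m : ℕ) (hm : 2 ≤ m) :
    (offAntidiagonals m).ncard = (m - 1) * (m - 2) ∧
    ∀ l : List (Fin m × Fin m), l.Nodup → (∀ e, e ∈ l ↔ e ∈ offAntidiagonals m) →
      RingTheory.Sequence.IsRegular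
        (MvPolynomial (Fin m × Fin m) K ⧸
          minorsIdeal (m - 1) (Matrix.mvPolynomialX (Fin m) (Fin m) K))
        (l.map fun e => Matrix.mvPolynomialX (Fin m) (Fin m) K e.1 e.2) :=
  (lemma3p4_general K m hm).imp_right fun h l hl hmem => h l hl fun e => (hmem e).mp
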